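/- Let $K,A,B$ be finite nonempty sets, let $M_k\in\mathbb{R}^{|A|\times|B|}$ $(k\in K)$, let $Q_a\in\mathbb{R}^{|K|\times|K|}$ $(a\in A)$ be row-stochastic matrices, let $p\in\Delta(K)$ and let $N$ be the number of stages. In the game $\Gamma_N(p)$ the first state $k_1$ has law $p$. At each stage $t=1,\dots,N$ the informed player (player 1), who knows $S_t=(k_1,\dots,k_t)$, $I_t=(a_1,\dots,a_{t-1})$ and $J_t=(b_1,\dots,b_{t-1})$, and the uninformed player (player 2), who knows only $I_t$ and $J_t$, simultaneously choose $a_t\in A$ and $b_t\in B$ by behavior strategies $\sigma=(\sigma_t)$ and $\tau=(\tau_t)$, and then $k_{t+1}$ has law $Q_{a_t}(k_t,:)$. Player 1 maximizes and player 2 minimizes $\gamma_N(p,\sigma,\tau)=\mathbf{E}\big[\sum_{t=1}^N M_{k_t}(a_t,b_t)\big]$. Let $v_N(p)=\min_\tau\max_\sigma\gamma_N(p,\sigma,\tau)$ be the value of the game (the security level of player 2); $\tau^*$ is a security strategy of player 2 if $\max_\sigma\gamma_N(p,\sigma,\tau^*)=v_N(p)$. For $\alpha\in\mathbb{R}^{|K|}$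 let $w_n(\alpha)=\min_\tau\max_{p',\sigma}\{p'^T\alpha+\gamma_n(p',\sigma,\tau)\}$ be the value of the $n$-stage dual game, in which player 1 also chooses the law $p'\in\Delta(K)$ of $k_1$ and receives $\alpha(k_1)$ in addition; in particular $w_0(\alpha)=\max_k\alpha(k)$. For $1\le t\le N$ and $\alpha\in\mathbb{R}^{|K|}$ consider the problem $$\mathcal{P}_t(\alpha):\quad \min_{\hat y\in\Delta(B)}\ \min_{(\beta_a)_{a\in A}\in(\mathbb{R}^{|K|})^{A}}\ \max_{\Pi\in\Delta(K\times A)}\ \sum_{k\in K,\,a\in A}\Pi(k,a)\big(M_k(a,:)\hat y+\alpha(k)-Q_a(k,:)\beta_a+w_{N-t}(\beta_a)\big).$$ Then the problem $\min_{\alpha\in\mathbb{R}^{|K|}}\{w_N(\alpha)-p^T\alpha\}$ has an optimal solution, and so does $\mathcal{P}_t(\alpha)$ for all $t$ and $\alpha$. Let $\hat\alpha_1$ be any optimal solution of the first problem, and for each $t$ and $\alpha$ choose any optimal solution $(\hat y^*(t,\alpha),(\beta^*_a(t,\alpha))_{a\in A})$ of $\mathcal{P}_t(\alpha)$. Define the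 regret at stage $t+1$ recursively by $\hat\alpha_{t+1}=\beta^*_{a_t}(t,\hat\alpha_t)$, where $a_t$ is the action of the informed player at stage $t$. Then $v_N(p)=w_N(\hat\alpha_1)-p^T\hat\alpha_1$, and the strategy of the uninformed player that plays the mixed action $\hat y^*(t,\hat\alpha_t)$ at each stage $t$ is a security strategy in $\Gamma_N(p)$. Its mixed action at stage $t$ depends only on $\hat\alpha_t$ and $t$; in particular it depends only on $t$ and on the action history $I_t$ of the informed player, not on $J_t$. -/

import Mathlib

noncomputable section

/-- The data `(K, A, B, M, Q)` of a two-player zero-sum stochastic game whose transitions are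
controlled by player 1: `M k a b` is the one-stage payoff of player 1 (cost of player 2) in state
`k`, and `Q a k k'` is the probability that the next state is `k'` when player 1 plays `a` in state
`k`. The initial distribution is a separate argument below. -/
structure StochasticGame (K A B : Type*) [Fintype K] where
  M : K → A → B → ℝ
  Q : A → K → stdSimplex ℝ K

/-- Behavior strategies of the informed player in an `N`-stage game. Stages are numbered
`0, …, N - 1`. At stage `t` player 1 has observed the states of stages `0, …, t` and all actions
of stages `0, …, t - 1`. -/
abbrev InformedStrategy (K A B : Type*) [Fintype A] (N : ℕ) :=
  (t : Fin N) → (Fin (t.val + 1) → K) → (Fin t.val → A) → (Fin t.val → B) → stdSimplex ℝ A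

/-- Behavior strategies of the uninformed player in an `N`-stage game. At stage `t` player 2 has
observed all actions of stages `0, …, t - 1`, and no state. -/
abbrev UninformedStrategy (A B : Type*) [Fintype B] (N : ℕ) :=
  (t : Fin N) → (Fin t.val → A) → (Fin t.val → B) → stdSimplex ℝ B

namespace StochasticGame

variable {K A B : Type*} [Fintype K] [Fintype A] [Fintype B]

/-- The part of the probability of a play that is due to nature: the initial law `p` of the first
state times the transition probabilities along the play. -/
def stateWeight (G : StochasticGame K A B) (p : stdSimplex ℝ K) :
    {N : ℕ} → (Fin N → K × A × B) → ℝ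
  | 0, _ => 1
  | n + 1, ω => p.1 (ω 0).1 *
      ∏ t : Fin n, (G.Q (ω t.castSucc).2.1 (ω t.castSucc).1).1 (ω t.succ).1

/-- The probability of the play `ω = (k_t, a_t, b_t)_t` induced by `p`, `σ`, `τ` and `Q`. -/
def playProb (G : StochasticGame K A B) {N : ℕ} (p : stdSimplex ℝ K)
    (σ : InformedStrategy K A B N) (τ : UninformedStrategy A B N) (ω : Fin N → K × A × B) : ℝ :=
  G.stateWeight p ω *
    ∏ t : Fin N,
      ((σ t (fun s => (ω (Fin.castLE t.isLt s)).1)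
          (fun s => (ω (Fin.castLE t.isLt.le s)).2.1)
          (fun s => (ω (Fin.castLE t.isLt.le s)).2.2)).1 (ω t).2.1 *
       (τ t (fun s => (ω (Fin.castLE t.isLt.le s)).2.1)
          (fun s => (ω (Fin.castLE t.isLt.le s)).2.2)).1 (ω t).2.2)

/-- The total payoff `γ_N(p, σ, τ)`: the expectation of `∑ t, M_{k_t}(a_t, b_t)`. -/
def payoff (G : StochasticGame K A B) {N : ℕ} (p : stdSimplex ℝ K)
    (σ : InformedStrategy K A B N) (τ : UninformedStrategy A B N) : ℝ :=
  ∑ ω : Fin N → K × A × B,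
    G.playProb p σ τ ω * ∑ t : Fin N, G.M (ω t).1 (ω t).2.1 (ω t).2.2

/-- The value `v_N(p)` of the primal game `Γ_N(p)`, as the minmax value, which is by definition
the security level of the uninformed player. -/
def value (G : StochasticGame K A B) (N : ℕ) (p : stdSimplex ℝ K) : ℝ :=
  ⨅ τ : UninformedStrategy A B N, ⨆ σ : InformedStrategy K A B N, G.payoff p σ τ

/-- `τ` is a security strategy of the uninformed player in `Γ_N(p)`:
`max_σ γ_N(p, σ, τ)` is the security level `v_N(p)`. -/
def IsSecurityStrategy (G : StochasticGame K A B) {N : ℕ} (p : stdSimplex ℝ K)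
    (τ : UninformedStrategy A B N) : Prop :=
  IsGreatest (Set.range fun σ : InformedStrategy K A B N => G.payoff p σ τ) (G.value N p)

/-- The payoff of the dual game `G_N(α)`, in which player 1 chooses the law `p` of the first state
`k_1` and receives `α(k_1)` on top of the stage payoffs. As `k_1` has law `p`, the expectation of
`α(k_1)` is `pᵀα`. -/
def dualPayoff (G : StochasticGame K A B) {N : ℕ} (α : K → ℝ) (p : stdSimplex ℝ K)
    (σ : InformedStrategy K A B N) (τ : UninformedStrategy A B N) : ℝ :=
  (∑ k, p.1 k * α k) + G.payoff p σ τ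

/-- The value `w_N(α)` of the dual game `G_N(α)`, as the minmax value. In the degenerate case
`N = 0` player 1 only chooses the state, and `w_0(α)` is the largest coordinate of `α`. -/
def dualValue (G : StochasticGame K A B) (N : ℕ) (α : K → ℝ) : ℝ :=
  ⨅ τ : UninformedStrategy A B N, ⨆ x : stdSimplex ℝ K × InformedStrategy K A B N,
    G.dualPayoff α x.1 x.2 τ

/-- `α` is a regret at the first stage of `Γ_N(p)`: an optimal solution of
`min_α {w_N(α) - pᵀα}`. -/
def IsInitialRegret (G : StochasticGame K A B) (N : ℕ) (p : stdSimplex ℝ K) (α : K → ℝ) : Prop :=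
  ∀ α' : K → ℝ,
    G.dualValue N α - ∑ k, p.1 k * α k ≤ G.dualValue N α' - ∑ k, p.1 k * α' k

/-- The function of `(y, β)` that is minimized in the regret update, when the current regret is
`α` and `n` stages remain after the current one:
`max_Π ∑_{k,a} Π(k,a) (M_k(a,:) y + α(k) - Q_a(k,:) β_a + w_n(β_a))`. -/
def updateObjective (G : StochasticGame K A B) (n : ℕ) (α : K → ℝ) (y : stdSimplex ℝ B)
    (β : A → K → ℝ) : ℝ :=
  ⨆ P : stdSimplex ℝ (K × A), ∑ k, ∑ a, P.1 (k, a) *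
    ((∑ b, G.M k a b * y.1 b) + α k - (∑ k', (G.Q a k).1 k' * β a k') + G.dualValue n (β a))

/-- `(y, β)` is an optimal solution of the minmax problem of the regret update. -/
def IsUpdateSolution (G : StochasticGame K A B) (n : ℕ) (α : K → ℝ) (y : stdSimplex ℝ B)
    (β : A → K → ℝ) : Prop :=
  ∀ (y' : stdSimplex ℝ B) (β' : A → K → ℝ),
    G.updateObjective n α y β ≤ G.updateObjective n α y' β'

/-- `y` and `β` select, for each stage `t` of an `N`-stage game and each regret `α` at that stage,
an optimal solution `(y t α, β t α)` of the minmax problem of the regret update; `N - (t + 1)`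
stages remain after stage `t`, since stages are numbered from `0`. -/
def IsUpdateRule (G : StochasticGame K A B) (N : ℕ) (y : ℕ → (K → ℝ) → stdSimplex ℝ B)
    (β : ℕ → (K → ℝ) → A → K → ℝ) : Prop :=
  ∀ t < N, ∀ α : K → ℝ, G.IsUpdateSolution (N - (t + 1)) α (y t α) (β t α)

end StochasticGame

/-- The regret at stage `t` after the action history `I` of the informed player: it is `α₁` at the
first stage, and if it is `α` at stage `t` and the informed player plays `a` there, then it is
`β t α a` at the next stage. -/
def regret {K A : Type*} (α₁ : K → ℝ) (β : ℕ → (K → ℝ) → A → K → ℝ) :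
    (t : ℕ) → (Fin t → A) → K → ℝ
  | 0, _ => α₁
  | t + 1, I => β t (regret α₁ β t (Fin.init I)) (I (Fin.last t))

/-- The strategy of the uninformed player produced by the regret algorithm: at stage `t`, play
`y t α`, where `α` is the current regret. -/
def regretStrategy {K A B : Type*} [Fintype B] (N : ℕ) (α₁ : K → ℝ)
    (y : ℕ → (K → ℝ) → stdSimplex ℝ B) (β : ℕ → (K → ℝ) → A → K → ℝ) :
    UninformedStrategy A B N :=
  fun t I _ => y t (regret α₁ β t I)

end

/-!
Player 1 knows the first state and alone controls the transitions, so against a fixed strategy `τ`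
of player 2 there is a largest payoff `bestReply τ k` for each first state `k`, computed by backward
induction, and one reply of player 1 achieves it for all `k` at once. Hence
`v_N(p) = min_τ ∑ k, p k * bestReply τ k` and `w_n(α) = min_τ max_k (α k + bestReply τ k)`, where
the minima exist because `bestReply` is continuous in `τ` and the strategy space is compact.

Call a vector `g` guaranteed in the `n`-stage game if `bestReply τ ≤ g` for some `τ`
(`guaranteeSet`). Then `w_n(α) ≤ c` iff the vector `c - α` is guaranteed (`dualValue_le_iff`), and
everything rests on two facts about guaranteed vectors.

* Recursion: `g` is guaranteed in `n + 1` stages iff there are a mixed action `y` and vectors `h a`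
  guaranteed in `n` stages with `M_k(a,:) y + Q_a(k,:) (h a) ≤ g k` for all `k` and `a`
  (`mem_guaranteeSet_succ`, `exists_of_mem_guaranteeSet_succ`). For the forward direction `h a` is
  the average of the vectors guaranteed after `(a, b)`, over player 2's own first action `b`.
* Convexity (`convex_guaranteeSet`), by induction from the recursion. It is what makes such averages
  guaranteed again, so that player 2 need not remember `b`.

With `h a = w_n(β_a) - β_a` in one direction and `β_a = -h a` in the other, the recursion says that
`w_{n+1}(α)` is the minimum of the regret update problem (`dualValue_succ_le`,
`exists_updateObjective_le`). By induction on the number of stages the regret strategy therefore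
guarantees `w_N(α) - α` (`bestReply_regretStrategy_le`).

Finally `v_N(p) = min_α (w_N(α) - pᵀα)`: an optimal strategy in the dual game guarantees
`w_N(α) - pᵀα` in the primal game, and equality holds for `α = -bestReply τ` with `τ` optimal in the
primal game. No minimax theorem is needed, as both values are minmax values. Averaging the
guarantee `w_N(α) - α` over `p` at an optimal `α` shows that the regret strategy is a security
strategy.
-/

noncomputable section

/-! ### Strategies by first stage and continuation -/

namespace UninformedStrategy

variable {A B : Type*} [Fintype B] {n : ℕ}

/-- The mixed action played at the first stage. -/
def head (τ : UninformedStrategy A B (n + 1)) : stdSimplex ℝ B :=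
  τ 0 Fin.elim0 Fin.elim0

/-- The continuation strategy after the first-stage actions `a` and `b`. -/
def tail (τ : UninformedStrategy A B (n + 1)) (a : A) (b : B) : UninformedStrategy A B n :=
  fun t I J => τ t.succ (Fin.cons a I) (Fin.cons b J)

/-- The strategy that plays `y` at the first stage and then, if player 1 has played `a`, continues
with `τ a` whatever player 2's own first action was. -/
def cons (y : stdSimplex ℝ B) (τ : A → UninformedStrategy A B n) :
    UninformedStrategy A B (n + 1) :=
  fun t => Fin.cases (motive := fun t : Fin (n + 1) =>
      (Fin t.val → A) → (Fin t.val → B) → stdSimplex ℝ B)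
    (fun _ _ => y) (fun t (I : Fin (t.val + 1) → A) (J : Fin (t.val + 1) → B) =>
      τ (I 0) t (Fin.tail I) (Fin.tail J)) t

@[simp]
lemma head_cons (y : stdSimplex ℝ B) (τ : A → UninformedStrategy A B n) :
    (cons y τ).head = y := rfl

@[simp]
lemma tail_cons (y : stdSimplex ℝ B) (τ : A → UninformedStrategy A B n) (a : A) (b : B) :
    (cons y τ).tail a b = τ a := rfl

lemma continuous_head : Continuous (head : UninformedStrategy A B (n + 1) → _) :=
  (continuous_apply _).comp ((continuous_apply _).comp (continuous_apply 0))

lemma continuous_tail (a : A) (b : B) :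
    Continuous fun τ : UninformedStrategy A B (n + 1) => τ.tail a b :=
  continuous_pi fun t => continuous_pi fun _ => continuous_pi fun _ =>
    (continuous_apply _).comp ((continuous_apply _).comp (continuous_apply t.succ))

end UninformedStrategy

namespace InformedStrategy

variable {K A B : Type*} [Fintype A] {n : ℕ}

/-- The mixed action played at the first stage in state `k`. -/
def head (σ : InformedStrategy K A B (n + 1)) (k : K) : stdSimplex ℝ A :=
  σ 0 (fun _ => k) Fin.elim0 Fin.elim0

/-- The continuation strategy after a first stage with state `k` and actions `a` and `b`. -/
def tail (σ : InformedStrategy K A B (n + 1)) (k : K) (a : A) (b : B) :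
    InformedStrategy K A B n :=
  fun t S I J => σ t.succ (Fin.cons k S) (Fin.cons a I) (Fin.cons b J)

/-- The strategy that plays `x k` at the first stage in state `k` and then, if the actions were
`a` and `b`, continues with `σ a b`. -/
def cons (x : K → stdSimplex ℝ A) (σ : A → B → InformedStrategy K A B n) :
    InformedStrategy K A B (n + 1) :=
  fun t => Fin.cases (motive := fun t : Fin (n + 1) =>
      (Fin (t.val + 1) → K) → (Fin t.val → A) → (Fin t.val → B) → stdSimplex ℝ A)
    (fun S _ _ => x (S 0))
    (fun t (S : Fin (t.val + 2) → K) (I : Fin (t.val + 1) → A) (J : Fin (t.val + 1) → B) =>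
      σ (I 0) (J 0) t (Fin.tail S) (Fin.tail I) (Fin.tail J)) t

@[simp]
lemma head_cons (x : K → stdSimplex ℝ A) (σ : A → B → InformedStrategy K A B n) (k : K) :
    (cons x σ).head k = x k := rfl

@[simp]
lemma tail_cons (x : K → stdSimplex ℝ A) (σ : A → B → InformedStrategy K A B n)
    (k : K) (a : A) (b : B) : (cons x σ).tail k a b = σ a b := rfl

end InformedStrategy

namespace StochasticGame

/-! ### The payoff stage by stage -/

variable {K A B : Type*} [Fintype K]

lemma stateWeight_cons (G : StochasticGame K A B) (p : stdSimplex ℝ K) {n : ℕ} (k : K) (a : A)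
    (b : B) (ω : Fin n → K × A × B) :
    G.stateWeight p (Fin.cons (k, a, b) ω : Fin (n + 1) → K × A × B) =
      p.1 k * G.stateWeight (G.Q a k) ω := by
  cases n with
  | zero => simp [stateWeight]
  | succ n =>
    simp only [stateWeight, Fin.prod_univ_succ, Fin.cons_zero, Fin.cons_succ, Fin.castSucc_zero,
      Fin.castSucc_succ]

/-- The histories along a play are those along its continuation, preceded by the first stage. -/
lemma comp_cons_castLE {X Y : Type*} {n m : ℕ} (f : X → Y) (x : X) (ω : Fin n → X)
    (h : m + 1 ≤ n + 1) :
    (fun s : Fin (m + 1) => f ((Fin.cons x ω : Fin (n + 1) → X) (Fin.castLE h s))) =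
      (Fin.cons (f x) fun s : Fin m => f (ω (Fin.castLE (Nat.le_of_succ_le_succ h) s)) :
        Fin (m + 1) → Y) := by
  funext s
  refine Fin.cases rfl (fun s => rfl) s

variable [Fintype A] [Fintype B]

lemma playProb_cons (G : StochasticGame K A B) (p : stdSimplex ℝ K) {n : ℕ}
    (σ : InformedStrategy K A B (n + 1)) (τ : UninformedStrategy A B (n + 1)) (k : K) (a : A)
    (b : B) (ω : Fin n → K × A × B) :
    G.playProb p σ τ (Fin.cons (k, a, b) ω : Fin (n + 1) → K × A × B) =
      p.1 k * ((InformedStrategy.head σ k).1 a * (UninformedStrategy.head τ).1 b *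
        G.playProb (G.Q a k) (InformedStrategy.tail σ k a b) (UninformedStrategy.tail τ a b) ω) := by
  have hσ : σ 0 (fun s => ((Fin.cons (k, a, b) ω : Fin (n + 1) → K × A × B)
        (Fin.castLE (Fin.isLt 0) s)).1) (fun s => ((Fin.cons (k, a, b) ω :
        Fin (n + 1) → K × A × B) (Fin.castLE (Fin.isLt 0).le s)).2.1) (fun s =>
        ((Fin.cons (k, a, b) ω : Fin (n + 1) → K × A × B) (Fin.castLE (Fin.isLt 0).le s)).2.2) =
      InformedStrategy.head σ k := by
    refine congr (congr (congrArg (σ 0) (funext fun s => ?_))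
      (Subsingleton.elim (α := Fin 0 → A) _ _)) (Subsingleton.elim (α := Fin 0 → B) _ _)
    obtain rfl : s = 0 := Subsingleton.elim (α := Fin 1) _ _
    rfl
  have hτ : τ 0 (fun s => ((Fin.cons (k, a, b) ω :
        Fin (n + 1) → K × A × B) (Fin.castLE (Fin.isLt 0).le s)).2.1) (fun s =>
        ((Fin.cons (k, a, b) ω : Fin (n + 1) → K × A × B) (Fin.castLE (Fin.isLt 0).le s)).2.2) =
      UninformedStrategy.head τ :=
    congr (congrArg (τ 0) (Subsingleton.elim (α := Fin 0 → A) _ _))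
      (Subsingleton.elim (α := Fin 0 → B) _ _)
  rw [playProb, playProb, stateWeight_cons, Fin.prod_univ_succ, hσ, hτ]
  -- the factor of stage `t + 1` of the play is the factor of stage `t` of its continuation
  have hprod : ∀ t : Fin n, _ = _ := fun t => congrArg₂ (· * ·)
    (congrArg (fun x : stdSimplex ℝ A => x.1 (ω t).2.1)
      (show σ t.succ _ _ _ = InformedStrategy.tail σ k a b t _ _ _ from
        congr (congr (congrArg (σ t.succ)
          (comp_cons_castLE (fun x => x.1) (k, a, b) ω (Nat.succ_le_succ t.isLt)))
          (comp_cons_castLE (fun x => x.2.1) (k, a, b) ω (Nat.succ_le_succ t.isLt.le)))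
          (comp_cons_castLE (fun x => x.2.2) (k, a, b) ω (Nat.succ_le_succ t.isLt.le))))
    (congrArg (fun x : stdSimplex ℝ B => x.1 (ω t).2.2)
      (show τ t.succ _ _ = UninformedStrategy.tail τ a b t _ _ from
        congr (congrArg (τ t.succ)
          (comp_cons_castLE (fun x => x.2.1) (k, a, b) ω (Nat.succ_le_succ t.isLt.le)))
          (comp_cons_castLE (fun x => x.2.2) (k, a, b) ω (Nat.succ_le_succ t.isLt.le))))
  have := Finset.prod_congr (rfl : (Finset.univ : Finset (Fin n)) = _) fun t _ => hprod t
  simp only [Fin.cons_zero, Fin.cons_succ]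
  -- `this` matches only up to unfolding `Fin.succ`, which `rw` does not see through
  refine (congrArg (fun z => p.1 k * G.stateWeight (G.Q a k) ω * ((InformedStrategy.head σ k).1 a *
    (UninformedStrategy.head τ).1 b * z)) this).trans ?_
  ring

lemma sum_plays_succ {n : ℕ} (f : (Fin (n + 1) → K × A × B) → ℝ) :
    ∑ ω, f ω = ∑ k, ∑ a, ∑ b, ∑ ω : Fin n → K × A × B, f (Fin.cons (k, a, b) ω) := by
  rw [← (Fin.consEquiv fun _ : Fin (n + 1) => K × A × B).sum_comp]
  simp only [Fintype.sum_prod_type]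
  rfl

lemma sum_playProb (G : StochasticGame K A B) {n : ℕ} (p : stdSimplex ℝ K)
    (σ : InformedStrategy K A B n) (τ : UninformedStrategy A B n) :
    ∑ ω, G.playProb p σ τ ω = 1 := by
  induction n generalizing p with
  | zero => simp [playProb, stateWeight]
  | succ n ih =>
    simp only [sum_plays_succ, playProb_cons, ← Finset.mul_sum, ih, mul_one]
    simp [(UninformedStrategy.head τ).2.2, (InformedStrategy.head σ _).2.2, p.2.2]

/-- After the first stage the play continues as in an `n`-stage game whose first state has law
`Q_a(k,:)`. -/
lemma payoff_succ (G : StochasticGame K A B) {n : ℕ} (p : stdSimplex ℝ K)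
    (σ : InformedStrategy K A B (n + 1)) (τ : UninformedStrategy A B (n + 1)) :
    G.payoff p σ τ = ∑ k, p.1 k * ∑ a, (InformedStrategy.head σ k).1 a *
      ∑ b, (UninformedStrategy.head τ).1 b * (G.M k a b +
        G.payoff (G.Q a k) (InformedStrategy.tail σ k a b) (UninformedStrategy.tail τ a b)) := by
  simp only [payoff, sum_plays_succ, playProb_cons, Fin.sum_univ_succ, Fin.cons_zero,
    Fin.cons_succ, Finset.mul_sum]
  refine Finset.sum_congr rfl fun k _ => Finset.sum_congr rfl fun a _ =>
    Finset.sum_congr rfl fun b _ => ?_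
  have h := G.sum_playProb (G.Q a k) (InformedStrategy.tail σ k a b)
    (UninformedStrategy.tail τ a b)
  set P := G.playProb (G.Q a k) (InformedStrategy.tail σ k a b) (UninformedStrategy.tail τ a b)
  set c := p.1 k * ((InformedStrategy.head σ k).1 a * (UninformedStrategy.head τ).1 b) with hc
  have e : ∀ ω, p.1 k * ((InformedStrategy.head σ k).1 a * (UninformedStrategy.head τ).1 b * P ω) *
      (G.M k a b + ∑ i, G.M (ω i).1 (ω i).2.1 (ω i).2.2) =
      c * (G.M k a b * P ω + P ω * ∑ i, G.M (ω i).1 (ω i).2.1 (ω i).2.2) := by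
    intro ω; rw [hc]; ring
  simp only [e, ← Finset.mul_sum, Finset.sum_add_distrib, h]
  rw [hc]; ring

/-! ### Best replies of the informed player -/

section BestReply

variable [Nonempty A]

/-- The largest total payoff that player 1 can achieve against `τ` when the first state is `k`,
by backward induction. -/
def bestReply (G : StochasticGame K A B) : {n : ℕ} → UninformedStrategy A B n → K → ℝ
  | 0, _, _ => 0
  | _ + 1, τ, k => Finset.univ.sup' Finset.univ_nonempty fun a : A =>
      ∑ b, (UninformedStrategy.head τ).1 b * (G.M k a b +
        ∑ k', (G.Q a k).1 k' * G.bestReply (UninformedStrategy.tail τ a b) k')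

lemma payoff_le_bestReply (G : StochasticGame K A B) {n : ℕ} (p : stdSimplex ℝ K)
    (σ : InformedStrategy K A B n) (τ : UninformedStrategy A B n) :
    G.payoff p σ τ ≤ ∑ k, p.1 k * G.bestReply τ k := by
  induction n generalizing p with
  | zero => simp [payoff, bestReply]
  | succ n ih =>
    rw [payoff_succ]
    refine Finset.sum_le_sum fun k _ => mul_le_mul_of_nonneg_left ?_ (p.2.1 k)
    calc _ ≤ ∑ a, (InformedStrategy.head σ k).1 a * G.bestReply τ k := by
          refine Finset.sum_le_sum fun a _ => mul_le_mul_of_nonneg_left ?_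
            ((InformedStrategy.head σ k).2.1 a)
          refine le_trans (Finset.sum_le_sum fun b _ => mul_le_mul_of_nonneg_left
            (add_le_add_right (ih _ _ _) _) ((UninformedStrategy.head τ).2.1 b)) ?_
          exact Finset.le_sup' (fun a : A => ∑ b, (UninformedStrategy.head τ).1 b * (G.M k a b +
            ∑ k', (G.Q a k).1 k' * G.bestReply (UninformedStrategy.tail τ a b) k'))
            (Finset.mem_univ a)
      _ = _ := by rw [← Finset.sum_mul, (InformedStrategy.head σ k).2.2, one_mul]

/-- One strategy is a best reply to `τ` whatever the law of the first state, since player 1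
observes that state. -/
lemma exists_payoff_eq_bestReply (G : StochasticGame K A B) {n : ℕ}
    (τ : UninformedStrategy A B n) :
    ∃ σ : InformedStrategy K A B n, ∀ p : stdSimplex ℝ K,
      G.payoff p σ τ = ∑ k, p.1 k * G.bestReply τ k := by
  classical
  induction n with
  | zero => exact ⟨fun t => t.elim0, fun p => by simp [payoff, bestReply]⟩
  | succ n ih =>
    choose σ hσ using fun a b => ih (UninformedStrategy.tail τ a b)
    have h : ∀ k : K, ∃ a : A, G.bestReply τ k = ∑ b, (UninformedStrategy.head τ).1 b *
        (G.M k a b + ∑ k', (G.Q a k).1 k' *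
          G.bestReply (UninformedStrategy.tail τ a b) k') := fun k => by
      obtain ⟨a, -, ha⟩ := Finset.exists_mem_eq_sup' (Finset.univ_nonempty (α := A))
        fun a : A => ∑ b, (UninformedStrategy.head τ).1 b * (G.M k a b +
          ∑ k', (G.Q a k).1 k' * G.bestReply (UninformedStrategy.tail τ a b) k')
      exact ⟨a, ha⟩
    choose a ha using h
    refine ⟨InformedStrategy.cons (fun k => ⟨Pi.single (a k) 1, single_mem_stdSimplex ℝ (a k)⟩) σ,
      fun p => ?_⟩
    simp [payoff_succ, hσ, ha, Pi.single_apply]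

lemma continuous_bestReply (G : StochasticGame K A B) {n : ℕ} (k : K) :
    Continuous fun τ : UninformedStrategy A B n => G.bestReply τ k := by
  induction n generalizing k with
  | zero => exact continuous_const
  | succ n ih =>
    refine Continuous.finset_sup'_apply _ fun a _ => continuous_finsetSum _ fun b _ => ?_
    refine ((continuous_apply b).comp
      (continuous_subtype_val.comp UninformedStrategy.continuous_head)).mul ?_
    exact continuous_const.add (continuous_finsetSum _ fun k' _ => continuous_const.mul
      ((ih k').comp (UninformedStrategy.continuous_tail a b)))

lemma isGreatest_payoff (G : StochasticGame K A B) {n : ℕ} (p : stdSimplex ℝ K)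
    (τ : UninformedStrategy A B n) :
    IsGreatest (Set.range fun σ : InformedStrategy K A B n => G.payoff p σ τ)
      (∑ k, p.1 k * G.bestReply τ k) := by
  obtain ⟨σ, hσ⟩ := G.exists_payoff_eq_bestReply τ
  exact ⟨⟨σ, hσ p⟩, by rintro _ ⟨σ', rfl⟩; exact G.payoff_le_bestReply p σ' τ⟩

lemma isGreatest_dualPayoff [Nonempty K] (G : StochasticGame K A B) {n : ℕ} (α : K → ℝ)
    (τ : UninformedStrategy A B n) :
    IsGreatest (Set.range fun x : stdSimplex ℝ K × InformedStrategy K A B n =>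
        G.dualPayoff α x.1 x.2 τ)
      (Finset.univ.sup' Finset.univ_nonempty fun k => α k + G.bestReply τ k) := by
  classical
  set m := Finset.univ.sup' Finset.univ_nonempty fun k => α k + G.bestReply τ k
  constructor
  · obtain ⟨σ, hσ⟩ := G.exists_payoff_eq_bestReply τ
    obtain ⟨k, -, hk⟩ := Finset.exists_mem_eq_sup' (Finset.univ_nonempty (α := K))
      fun k => α k + G.bestReply τ k
    refine ⟨(⟨Pi.single k 1, single_mem_stdSimplex ℝ k⟩, σ), ?_⟩
    simp [dualPayoff, hσ, Pi.single_apply, m, hk]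
  · rintro _ ⟨⟨p, σ⟩, rfl⟩
    calc G.dualPayoff α p σ τ ≤ (∑ k, p.1 k * α k) + ∑ k, p.1 k * G.bestReply τ k :=
          add_le_add_right (G.payoff_le_bestReply p σ τ) _
      _ = ∑ k, p.1 k * (α k + G.bestReply τ k) := by
          simp only [mul_add, Finset.sum_add_distrib]
      _ ≤ ∑ k, p.1 k * m := Finset.sum_le_sum fun k _ => mul_le_mul_of_nonneg_left
          (Finset.le_sup' (fun k => α k + G.bestReply τ k) (Finset.mem_univ k)) (p.2.1 k)
      _ = m := by rw [← Finset.sum_mul, p.2.2, one_mul]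

/-! ### The objective of the regret update -/

/-- The objective is the maximum of a linear function over the simplex `Δ(K × A)`, which is attained
at a vertex. -/
lemma updateObjective_le_iff [Nonempty K] (G : StochasticGame K A B) {n : ℕ} {α : K → ℝ}
    {y : stdSimplex ℝ B} {β : A → K → ℝ} {c : ℝ} :
    G.updateObjective n α y β ≤ c ↔ ∀ k a, (∑ b, G.M k a b * y.1 b) + α k -
      (∑ k', (G.Q a k).1 k' * β a k') + G.dualValue n (β a) ≤ c := by
  classical
  set f : K × A → ℝ := fun x => (∑ b, G.M x.1 x.2 b * y.1 b) + α x.1 -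
    (∑ k', (G.Q x.2 x.1).1 k' * β x.2 k') + G.dualValue n (β x.2) with hf
  have he : G.updateObjective n α y β = ⨆ P : stdSimplex ℝ (K × A), ∑ x, P.1 x * f x := by
    simp only [updateObjective, Fintype.sum_prod_type, hf]
  -- a probability-weighted average of values at most `d` is at most `d`
  have hle : ∀ (d : ℝ) (_ : ∀ x, f x ≤ d) (P : stdSimplex ℝ (K × A)), ∑ x, P.1 x * f x ≤ d :=
    fun d hd P => (Finset.sum_le_sum fun x _ => mul_le_mul_of_nonneg_left (hd x) (P.2.1 x)).trans
      (by rw [← Finset.sum_mul, P.2.2, one_mul])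
  rw [he]
  constructor
  · intro h k a
    refine le_trans ?_ h
    obtain ⟨d, hd⟩ := (Set.finite_range f).bddAbove
    have hb : BddAbove (Set.range fun P : stdSimplex ℝ (K × A) => ∑ x, P.1 x * f x) :=
      ⟨d, by rintro _ ⟨P, rfl⟩; exact hle d (fun x => hd ⟨x, rfl⟩) P⟩
    refine le_trans (le_of_eq ?_)
      (le_ciSup hb ⟨Pi.single (k, a) 1, single_mem_stdSimplex ℝ (k, a)⟩)
    simp [Pi.single_apply, hf]
  · intro h
    exact ciSup_le (hle c fun x => h x.1 x.2)

/-! ### Guaranteed payoff vectors -/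

/-- The vectors `g` such that player 2 has one strategy in the `n`-stage game that keeps the
expected total payoff at most `g k` for every first state `k`. -/
def guaranteeSet (G : StochasticGame K A B) (n : ℕ) : Set (K → ℝ) :=
  {g | ∃ τ : UninformedStrategy A B n, ∀ k, G.bestReply τ k ≤ g k}

/-- A strategy of the `(n + 1)`-stage game can be assembled from a first mixed action and one
guaranteed vector of the `n`-stage game for each action of player 1. -/
lemma mem_guaranteeSet_succ (G : StochasticGame K A B) {n : ℕ} {g : K → ℝ} (y : stdSimplex ℝ B)
    (h : A → K → ℝ) (hh : ∀ a, h a ∈ G.guaranteeSet n)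
    (hg : ∀ k a, (∑ b, G.M k a b * y.1 b) + ∑ k', (G.Q a k).1 k' * h a k' ≤ g k) :
    g ∈ G.guaranteeSet (n + 1) := by
  choose τ hτ using hh
  refine ⟨UninformedStrategy.cons y τ, fun k => Finset.sup'_le _ _ fun a _ => ?_⟩
  refine le_trans ?_ (hg k a)
  simp only [UninformedStrategy.head_cons, UninformedStrategy.tail_cons, mul_add,
    Finset.sum_add_distrib, ← Finset.sum_mul, y.2.2, one_mul]
  refine add_le_add (Finset.sum_le_sum fun b _ => (mul_comm _ _).le) ?_
  exact Finset.sum_le_sum fun k' _ => mul_le_mul_of_nonneg_left (hτ a k') ((G.Q a k).2.1 k')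

/-- Averaging over player 2's own first action shows that player 2 loses nothing by forgetting
it. -/
lemma exists_of_mem_guaranteeSet_succ (G : StochasticGame K A B) {n : ℕ}
    (hc : Convex ℝ (G.guaranteeSet n)) {g : K → ℝ} (hg : g ∈ G.guaranteeSet (n + 1)) :
    ∃ (y : stdSimplex ℝ B) (h : A → K → ℝ), (∀ a, h a ∈ G.guaranteeSet n) ∧
      ∀ k a, (∑ b, G.M k a b * y.1 b) + ∑ k', (G.Q a k).1 k' * h a k' ≤ g k := by
  obtain ⟨τ, hτ⟩ := hg
  refine ⟨UninformedStrategy.head τ, fun a => ∑ b, (UninformedStrategy.head τ).1 b •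
    G.bestReply (UninformedStrategy.tail τ a b), fun a => ?_, fun k a => ?_⟩
  · exact hc.sum_mem (fun b _ => (UninformedStrategy.head τ).2.1 b)
      (UninformedStrategy.head τ).2.2 fun b _ => ⟨_, fun _ => le_rfl⟩
  · refine le_trans (le_of_eq ?_) ((Finset.le_sup' (fun a : A =>
      ∑ b, (UninformedStrategy.head τ).1 b * (G.M k a b +
        ∑ k', (G.Q a k).1 k' * G.bestReply (UninformedStrategy.tail τ a b) k'))
      (Finset.mem_univ a)).trans (hτ k))
    simp only [Finset.sum_apply, Pi.smul_apply, smul_eq_mul, mul_add, Finset.sum_add_distrib,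
      Finset.mul_sum]
    congr 1
    · exact Finset.sum_congr rfl fun b _ => mul_comm _ _
    · rw [Finset.sum_comm]
      exact Finset.sum_congr rfl fun b _ => Finset.sum_congr rfl fun k' _ => mul_left_comm _ _ _

lemma convex_guaranteeSet (G : StochasticGame K A B) (n : ℕ) : Convex ℝ (G.guaranteeSet n) := by
  induction n with
  | zero =>
    -- without stages, the guaranteed vectors are the nonnegative ones
    rintro g ⟨τ, hg⟩ g' ⟨_, hg'⟩ s t hs ht -
    exact ⟨τ, fun k => add_nonneg (mul_nonneg hs (hg k)) (mul_nonneg ht (hg' k))⟩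
  | succ n ih =>
    intro g hg g' hg' s t hs ht hst
    obtain ⟨y, h, hh, hy⟩ := G.exists_of_mem_guaranteeSet_succ ih hg
    obtain ⟨y', h', hh', hy'⟩ := G.exists_of_mem_guaranteeSet_succ ih hg'
    refine G.mem_guaranteeSet_succ
      ⟨s • y.1 + t • y'.1, convex_stdSimplex ℝ B y.2 y'.2 hs ht hst⟩
      (fun a => s • h a + t • h' a) (fun a => ih (hh a) (hh' a) hs ht hst) fun k a => ?_
    refine le_trans (le_of_eq ?_) (add_le_add (mul_le_mul_of_nonneg_left (hy k a) hs)
      (mul_le_mul_of_nonneg_left (hy' k a) ht))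
    simp only [Pi.add_apply, Pi.smul_apply, smul_eq_mul, mul_add, Finset.sum_add_distrib,
      Finset.mul_sum, mul_left_comm]
    ring

/-! ### Optimal strategies of the uninformed player -/

variable [Nonempty B]

/-- Player 2 has an optimal strategy in the primal game. -/
lemma exists_forall_value_le (G : StochasticGame K A B) (N : ℕ) (p : stdSimplex ℝ K) :
    ∃ τ : UninformedStrategy A B N, G.value N p = ∑ k, p.1 k * G.bestReply τ k ∧
      ∀ τ' : UninformedStrategy A B N, G.value N p ≤ ∑ k, p.1 k * G.bestReply τ' k := by
  have hc : Continuous fun τ : UninformedStrategy A B N => ∑ k, p.1 k * G.bestReply τ k :=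
    continuous_finsetSum _ fun k _ => continuous_const.mul (G.continuous_bestReply k)
  have hv : G.value N p = ⨅ τ : UninformedStrategy A B N, ∑ k, p.1 k * G.bestReply τ k :=
    iInf_congr fun τ => (G.isGreatest_payoff p τ).csSup_eq
  obtain ⟨τ, -, hτ⟩ := isCompact_univ.exists_isMinOn Set.univ_nonempty hc.continuousOn
  have hτ' : ∀ τ', _ := fun τ' => hτ (Set.mem_univ τ')
  have he : G.value N p = ∑ k, p.1 k * G.bestReply τ k :=
    hv.trans (IsLeast.csInf_eq ⟨⟨τ, rfl⟩, by rintro _ ⟨τ', rfl⟩; exact hτ' τ'⟩)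
  exact ⟨τ, he, fun τ' => he ▸ hτ' τ'⟩

variable [Nonempty K]

/-- The dual value is attained: player 2 has an optimal strategy in the dual game. -/
lemma isLeast_dualValue (G : StochasticGame K A B) (n : ℕ) (α : K → ℝ) :
    IsLeast {c : ℝ | ∃ τ : UninformedStrategy A B n, ∀ k, G.bestReply τ k ≤ c - α k}
      (G.dualValue n α) := by
  have hc : Continuous fun τ : UninformedStrategy A B n =>
      Finset.univ.sup' Finset.univ_nonempty fun k => α k + G.bestReply τ k :=
    Continuous.finset_sup'_apply _ fun k _ => continuous_const.add (G.continuous_bestReply k)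
  have hv : G.dualValue n α = ⨅ τ : UninformedStrategy A B n,
      Finset.univ.sup' Finset.univ_nonempty fun k => α k + G.bestReply τ k :=
    iInf_congr fun τ => (G.isGreatest_dualPayoff α τ).csSup_eq
  obtain ⟨τ, -, hτ⟩ := isCompact_univ.exists_isMinOn Set.univ_nonempty hc.continuousOn
  have hτ' : ∀ τ', _ := fun τ' => hτ (Set.mem_univ τ')
  have he := hv.trans (IsLeast.csInf_eq ⟨⟨τ, rfl⟩, by rintro _ ⟨τ', rfl⟩; exact hτ' τ'⟩)
  constructor
  · refine ⟨τ, fun k => ?_⟩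
    have := Finset.le_sup' (fun k => α k + G.bestReply τ k) (Finset.mem_univ k)
    rw [he]; linarith
  · rintro c ⟨τ', h⟩
    rw [he]
    exact (hτ' τ').trans (Finset.sup'_le _ _ fun k _ => by linarith [h k])

/-! ### The dual value and its recursion -/

lemma dualValue_le_iff (G : StochasticGame K A B) {n : ℕ} {α : K → ℝ} {c : ℝ} :
    G.dualValue n α ≤ c ↔ (fun k => c - α k) ∈ G.guaranteeSet n := by
  refine ⟨fun h => ?_, fun h => (G.isLeast_dualValue n α).2 h⟩
  obtain ⟨τ, hτ⟩ := (G.isLeast_dualValue n α).1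
  exact ⟨τ, fun k => (hτ k).trans (sub_le_sub_right h _)⟩

/-- Player 2 plays `y` and then, after the action `a`, optimally in the dual game with regret `β a`;
that continuation guarantees `w_n(β_a) - β_a`. -/
lemma dualValue_succ_le (G : StochasticGame K A B) (n : ℕ) (α : K → ℝ) (y : stdSimplex ℝ B)
    (β : A → K → ℝ) : G.dualValue (n + 1) α ≤ G.updateObjective n α y β := by
  refine G.dualValue_le_iff.2 (G.mem_guaranteeSet_succ y
    (fun a k => G.dualValue n (β a) - β a k) (fun a => G.dualValue_le_iff.1 le_rfl) fun k a => ?_)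
  have := G.updateObjective_le_iff.1 (le_refl (G.updateObjective n α y β)) k a
  simp only [mul_sub, Finset.sum_sub_distrib, ← Finset.sum_mul, (G.Q a k).2.2, one_mul]
  linarith

lemma exists_updateObjective_le (G : StochasticGame K A B) (n : ℕ) (α : K → ℝ) :
    ∃ (y : stdSimplex ℝ B) (β : A → K → ℝ),
      G.updateObjective n α y β ≤ G.dualValue (n + 1) α := by
  obtain ⟨y, h, hh, hy⟩ := G.exists_of_mem_guaranteeSet_succ (G.convex_guaranteeSet n)
    (G.dualValue_le_iff.1 (le_refl (G.dualValue (n + 1) α)))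
  refine ⟨y, fun a => -h a, G.updateObjective_le_iff.2 fun k a => ?_⟩
  have h0 : G.dualValue n (-h a) ≤ 0 := G.dualValue_le_iff.2 (by simpa using hh a)
  have := hy k a
  simp only [Pi.neg_apply, mul_neg, Finset.sum_neg_distrib]
  linarith

lemma exists_isUpdateSolution (G : StochasticGame K A B) (n : ℕ) (α : K → ℝ) :
    ∃ (y : stdSimplex ℝ B) (β : A → K → ℝ), G.IsUpdateSolution n α y β := by
  obtain ⟨y, β, h⟩ := G.exists_updateObjective_le n α
  exact ⟨y, β, fun y' β' => h.trans (G.dualValue_succ_le n α y' β')⟩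

lemma IsUpdateSolution.updateObjective_eq {G : StochasticGame K A B} {n : ℕ} {α : K → ℝ}
    {y : stdSimplex ℝ B} {β : A → K → ℝ} (h : G.IsUpdateSolution n α y β) :
    G.updateObjective n α y β = G.dualValue (n + 1) α := by
  obtain ⟨y', β', h'⟩ := G.exists_updateObjective_le n α
  exact ((h y' β').trans h').antisymm (G.dualValue_succ_le n α y β)

/-! ### The duality between the primal and the dual game -/

/-- An optimal strategy of player 2 in the dual game guarantees `w_N(α) - pᵀα` in `Γ_N(p)`. -/
lemma value_le_dualValue_sub (G : StochasticGame K A B) (N : ℕ) (p : stdSimplex ℝ K)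
    (α : K → ℝ) : G.value N p ≤ G.dualValue N α - ∑ k, p.1 k * α k := by
  obtain ⟨τ, hτ⟩ := (G.isLeast_dualValue N α).1
  obtain ⟨-, -, hv⟩ := G.exists_forall_value_le N p
  calc _ ≤ ∑ k, p.1 k * G.bestReply τ k := hv τ
    _ ≤ ∑ k, p.1 k * (G.dualValue N α - α k) :=
        Finset.sum_le_sum fun k _ => mul_le_mul_of_nonneg_left (hτ k) (p.2.1 k)
    _ = _ := by simp only [mul_sub, Finset.sum_sub_distrib, ← Finset.sum_mul, p.2.2, one_mul]

/-- The regret `-g`, where `g` is the vector guaranteed by an optimal strategy of player 2 in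
`Γ_N(p)`, attains the bound of `value_le_dualValue_sub`. -/
lemma exists_dualValue_sub_le (G : StochasticGame K A B) (N : ℕ) (p : stdSimplex ℝ K) :
    ∃ α : K → ℝ, G.dualValue N α - ∑ k, p.1 k * α k ≤ G.value N p := by
  obtain ⟨τ, hτ, -⟩ := G.exists_forall_value_le N p
  refine ⟨-G.bestReply τ, ?_⟩
  have h0 : G.dualValue N (-G.bestReply τ) ≤ 0 :=
    G.dualValue_le_iff.2 ⟨τ, fun k => by simp⟩
  simp only [Pi.neg_apply, mul_neg, Finset.sum_neg_distrib]
  linarith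

lemma exists_isInitialRegret (G : StochasticGame K A B) (N : ℕ) (p : stdSimplex ℝ K) :
    ∃ α : K → ℝ, G.IsInitialRegret N p α := by
  obtain ⟨α, h⟩ := G.exists_dualValue_sub_le N p
  exact ⟨α, fun α' => h.trans (G.value_le_dualValue_sub N p α')⟩

lemma IsInitialRegret.value_eq {G : StochasticGame K A B} {N : ℕ} {p : stdSimplex ℝ K}
    {α : K → ℝ} (h : G.IsInitialRegret N p α) :
    G.value N p = G.dualValue N α - ∑ k, p.1 k * α k := by
  obtain ⟨α', h'⟩ := G.exists_dualValue_sub_le N p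
  exact (G.value_le_dualValue_sub N p α).antisymm ((h α').trans h')

end BestReply

end StochasticGame

/-! ### The regret strategy -/

/-- Regrets may be updated from the first action onwards instead of up to the last one. -/
lemma regret_cons {K A : Type*} (α : K → ℝ) (β : ℕ → (K → ℝ) → A → K → ℝ) (a : A) (t : ℕ)
    (I : Fin t → A) :
    regret α β (t + 1) (Fin.cons a I) = regret (β 0 α a) (fun s => β (s + 1)) t I := by
  induction t with
  | zero => rfl
  | succ t ih =>
    have hI : Fin.init (Fin.cons a I : Fin (t + 2) → A) = Fin.cons a (Fin.init I) := by
      funext s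
      exact Fin.cases rfl (fun _ => rfl) s
    change β (t + 1) (regret α β (t + 1) (Fin.init (Fin.cons a I : Fin (t + 2) → A))) _ = _
    rw [hI, ih]
    rfl

lemma tail_regretStrategy {K A B : Type*} [Fintype B] (n : ℕ) (α : K → ℝ)
    (y : ℕ → (K → ℝ) → stdSimplex ℝ B) (β : ℕ → (K → ℝ) → A → K → ℝ) (a : A) (b : B) :
    UninformedStrategy.tail (regretStrategy (n + 1) α y β) a b =
      regretStrategy n (β 0 α a) (fun s => y (s + 1)) fun s => β (s + 1) := by
  funext t I J
  exact congrArg (y (t + 1)) (regret_cons α β a t I)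

namespace StochasticGame

variable {K A B : Type*} [Fintype K] [Fintype A] [Fintype B] [Nonempty K] [Nonempty A] [Nonempty B]

/-- The regret strategy is optimal for player 2 in the dual game. -/
lemma bestReply_regretStrategy_le (G : StochasticGame K A B) {N : ℕ} (α : K → ℝ)
    {y : ℕ → (K → ℝ) → stdSimplex ℝ B} {β : ℕ → (K → ℝ) → A → K → ℝ}
    (h : G.IsUpdateRule N y β) (k : K) :
    G.bestReply (regretStrategy N α y β : UninformedStrategy A B N) k ≤
      G.dualValue N α - α k := by
  induction N generalizing α y β k with
  | zero =>
    -- without stages, every strategy has best-reply value `0`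
    obtain ⟨τ, hτ⟩ := (G.isLeast_dualValue 0 α).1
    exact hτ k
  | succ n ih =>
    have hrule : G.IsUpdateRule n (fun s => y (s + 1)) fun s => β (s + 1) := fun t ht α' => by
      have := h (t + 1) (Nat.succ_lt_succ ht) α'
      rwa [Nat.add_sub_add_right] at this
    have hsol : G.IsUpdateSolution n α (y 0 α) (β 0 α) := h 0 n.succ_pos α
    refine Finset.sup'_le _ _ fun a _ => ?_
    have hobj := G.updateObjective_le_iff.1 hsol.updateObjective_eq.le k a
    -- player 2's own first action plays no role in the continuation, so the sum over it collapses
    simp only [tail_regretStrategy, mul_add, Finset.sum_add_distrib, ← Finset.sum_mul,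
      (UninformedStrategy.head _).2.2, one_mul]
    have h1 : ∑ k', (G.Q a k).1 k' * G.bestReply (regretStrategy n (β 0 α a)
          (fun s => y (s + 1)) (fun s => β (s + 1)) : UninformedStrategy A B n) k' ≤
        ∑ k', (G.Q a k).1 k' * (G.dualValue n (β 0 α a) - β 0 α a k') :=
      Finset.sum_le_sum fun k' _ => mul_le_mul_of_nonneg_left (ih (β 0 α a) hrule k')
        ((G.Q a k).2.1 k')
    simp only [mul_sub, Finset.sum_sub_distrib, ← Finset.sum_mul, (G.Q a k).2.2, one_mul] at h1
    have h2 : ∑ b, (UninformedStrategy.head (regretStrategy (n + 1) α y β)).1 b * G.M k a b =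
        ∑ b, G.M k a b * (y 0 α).1 b := Finset.sum_congr rfl fun b _ => mul_comm _ _
    rw [h2]
    linarith

lemma isSecurityStrategy_regretStrategy (G : StochasticGame K A B) {N : ℕ} {p : stdSimplex ℝ K}
    {α : K → ℝ} {y : ℕ → (K → ℝ) → stdSimplex ℝ B} {β : ℕ → (K → ℝ) → A → K → ℝ}
    (hα : G.IsInitialRegret N p α) (h : G.IsUpdateRule N y β) :
    G.IsSecurityStrategy p (regretStrategy N α y β) := by
  obtain ⟨-, -, hv⟩ := G.exists_forall_value_le N p
  have hle : ∑ k, p.1 k * G.bestReply (regretStrategy N α y β : UninformedStrategy A B N) k ≤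
      G.value N p := by
    rw [hα.value_eq]
    refine (Finset.sum_le_sum fun k _ => mul_le_mul_of_nonneg_left
      (G.bestReply_regretStrategy_le α h k) (p.2.1 k)).trans (le_of_eq ?_)
    simp only [mul_sub, Finset.sum_sub_distrib, ← Finset.sum_mul, p.2.2, one_mul]
  rw [IsSecurityStrategy, (hv (regretStrategy N α y β)).antisymm hle]
  exact G.isGreatest_payoff p _

end StochasticGame

end

theorem mainTheorem2 {K A B : Type*} [Fintype K] [Fintype A] [Fintype B] [Nonempty A] [Nonempty B]
    (G : StochasticGame K A B) (N : ℕ) (p : stdSimplex ℝ K) :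
    (∃ α₁ : K → ℝ, G.IsInitialRegret N p α₁) ∧
    (∃ (y : ℕ → (K → ℝ) → stdSimplex ℝ B) (β : ℕ → (K → ℝ) → A → K → ℝ),
      G.IsUpdateRule N y β) ∧
    ∀ (α₁ : K → ℝ) (y : ℕ → (K → ℝ) → stdSimplex ℝ B) (β : ℕ → (K → ℝ) → A → K → ℝ),
      G.IsInitialRegret N p α₁ → G.IsUpdateRule N y β →
        G.value N p = G.dualValue N α₁ - ∑ k, p.1 k * α₁ k ∧
        G.IsSecurityStrategy p (regretStrategy N α₁ y β) ∧
        (∀ (t : Fin N) (I : Fin t.val → A) (J : Fin t.val → B),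
          regretStrategy N α₁ y β t I J = y t (regret α₁ β t I)) ∧
        (∀ (t : Fin N) (I : Fin t.val → A) (J J' : Fin t.val → B),
          regretStrategy N α₁ y β t I J = regretStrategy N α₁ y β t I J') := by
  -- the state space is nonempty, since it carries a probability vector
  have : Nonempty K := by
    by_contra hK
    rw [not_nonempty_iff] at hK
    simpa using p.2.2
  refine ⟨G.exists_isInitialRegret N p, ?_, fun α₁ y β hα h => ⟨hα.value_eq,
    G.isSecurityStrategy_regretStrategy hα h, fun _ _ _ => rfl, fun _ _ _ _ => rfl⟩⟩
  choose y β h using fun (t : ℕ) (α : K → ℝ) => G.exists_isUpdateSolution (N - (t + 1)) α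
  exact ⟨y, β, fun t _ α => h t α⟩
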